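/- Let $D$ be a skew field, $\sigma : D \to D$ a ring automorphism and $\delta : D \to D$ a $\sigma$-derivation, i.e. an additive map with $\delta(ab) = \sigma(a)\delta(b) + \delta(a)b$ for all $a,b\in D$. Let $R = D[X;\sigma,\delta]$ be the Ore extension: the ring of left polynomials $\sum_i a_i X^i$ ($a_i \in D$) with $Xa = \sigma(a)X + \delta(a)$ for $a \in D$. Assume that $R$ is a finitely generated free module of rank $r$ over its center $C$. A polynomial $g \in R$ is twosided if $Rg = gR$. A bound of $f \in R$ is a twosided polynomial $f^* \in R$ such that $Rf^* = f^*R$ is the largest twosided ideal of $R$ contained in $Rf$; it is determined up to left multiplication by nonzero elements of $D$. A prime twosided polynomial is a twosided polynomial $\pi$ of positive degree such that $R\pi$ is maximal among the proper twosided ideals of $R$. A polynomial $f$ of positive degree is irreducible if, whenever $f = gh$ with $g, h \in R$, then $g \in D$ or $h \in D$. **Proposition.** Let $f \in R$ have a bound $f^*$ which lies in $C$. If $f^*$ is a prime twosided polynomial and $\deg f^* = \sqrt{r}\,\deg f$, then $f$ is irreducible. -/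

import Mathlib

/-- A `σ`-derivation of `D`: an additive map `δ` with `δ (a b) = σ a * δ b + δ a * b`. -/
structure SkewDerivation {D : Type*} [DivisionRing D] (σ : D ≃+* D) extends D →+ D where
  leibniz' : ∀ a b : D, toFun (a * b) = σ a * toFun b + toFun a * b

/-- The Ore extension `D[X; σ, δ]`: left polynomials `∑ aₙ Xⁿ`, given by their coefficients.
The ring structure, determined by `X a = σ(a) X + δ(a)`, is constructed below. -/
def OrePolynomial {D : Type*} [DivisionRing D] (σ : D ≃+* D) (_δ : SkewDerivation σ) : Type _ :=
  ℕ →₀ D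

namespace OrePolynomial

noncomputable section

variable {D : Type*} [DivisionRing D] {σ : D ≃+* D} {δ : SkewDerivation σ}

instance : AddCommGroup (OrePolynomial σ δ) := inferInstanceAs (AddCommGroup (ℕ →₀ D))

/-- The monomial `a Xⁿ`, additive in `a`. -/
def monomial (n : ℕ) : D →+ OrePolynomial σ δ := Finsupp.singleAddHom n

/-- The coefficient of `Xⁿ`. -/
def coeff (f : OrePolynomial σ δ) (n : ℕ) : D := (show ℕ →₀ D from f) n

/-- The degree of a polynomial, with the value `0` at the zero polynomial. -/
def natDegree (f : OrePolynomial σ δ) : ℕ := (show ℕ →₀ D from f).support.sup id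

/-- Additive maps out of `D[X; σ, δ]` are determined by (arbitrary) values on monomials. -/
def lift {M : Type*} [AddCommMonoid M] (φ : ℕ → D →+ M) : OrePolynomial σ δ →+ M :=
  Finsupp.liftAddHom φ

lemma lift_monomial {M : Type*} [AddCommMonoid M] (φ : ℕ → D →+ M) (n : ℕ) (a : D) :
    lift φ (monomial n a : OrePolynomial σ δ) = φ n a :=
  Finsupp.liftAddHom_apply_single φ n a

lemma hom_ext {M : Type*} [AddCommMonoid M] {φ ψ : OrePolynomial σ δ →+ M}
    (h : ∀ n a, φ (monomial n a) = ψ (monomial n a)) : φ = ψ :=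
  Finsupp.addHom_ext h

lemma end_ext {φ ψ : AddMonoid.End (OrePolynomial σ δ)}
    (h : ∀ n a, φ (monomial n a) = ψ (monomial n a)) : φ = ψ :=
  Finsupp.addHom_ext h

lemma end_mul_apply (φ ψ : AddMonoid.End (OrePolynomial σ δ)) (f : OrePolynomial σ δ) :
    (φ * ψ) f = φ (ψ f) := rfl

lemma end_add_apply (φ ψ : AddMonoid.End (OrePolynomial σ δ)) (f : OrePolynomial σ δ) :
    (φ + ψ) f = φ f + ψ f := rfl

/-- Left multiplication by a scalar, `b Xⁿ ↦ (a b) Xⁿ`. -/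
def scalarEnd : D →+ AddMonoid.End (OrePolynomial σ δ) :=
  AddMonoidHom.mk' (fun a => lift fun n => (monomial n).comp (AddMonoidHom.mulLeft a))
    fun a b => end_ext fun n c => by
      refine (lift_monomial _ n c).trans (Eq.trans ?_ (congrArg₂ (· + ·)
        (lift_monomial (fun n => (monomial n).comp (AddMonoidHom.mulLeft a)) n c).symm
        (lift_monomial (fun n => (monomial n).comp (AddMonoidHom.mulLeft b)) n c).symm))
      simp [add_mul]

/-- Left multiplication by `X`, `b Xⁿ ↦ σ(b) Xⁿ⁺¹ + δ(b) Xⁿ`. -/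
def xEnd : AddMonoid.End (OrePolynomial σ δ) :=
  lift fun n => (monomial (n + 1)).comp (σ : D →+ D) + (monomial n).comp δ.toAddMonoidHom

lemma scalarEnd_monomial (a b : D) (n : ℕ) :
    scalarEnd a (monomial n b : OrePolynomial σ δ) = monomial n (a * b) :=
  lift_monomial _ n b

lemma xEnd_monomial (b : D) (n : ℕ) :
    xEnd (monomial n b : OrePolynomial σ δ)
      = monomial (n + 1) (σ b) + monomial n (δ.toAddMonoidHom b) :=
  lift_monomial _ n b

lemma scalarEnd_one : (scalarEnd 1 : AddMonoid.End (OrePolynomial σ δ)) = 1 :=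
  end_ext fun n b => by rw [scalarEnd_monomial, one_mul]; rfl

lemma scalarEnd_mul (a b : D) :
    (scalarEnd (a * b) : AddMonoid.End (OrePolynomial σ δ)) = scalarEnd a * scalarEnd b :=
  end_ext fun n c => by
    rw [end_mul_apply]
    simp only [scalarEnd_monomial, mul_assoc]

lemma xEnd_mul_scalarEnd (a : D) :
    (xEnd * scalarEnd a : AddMonoid.End (OrePolynomial σ δ))
      = scalarEnd (σ a) * xEnd + scalarEnd (δ.toAddMonoidHom a) :=
  end_ext fun n b => by
    have h : δ.toAddMonoidHom (a * b)
      = σ a * δ.toAddMonoidHom b + δ.toAddMonoidHom a * b := δ.leibniz' a b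
    rw [end_add_apply, end_mul_apply, end_mul_apply]
    simp only [scalarEnd_monomial, xEnd_monomial, map_add, map_mul, h]
    abel

/-- Left multiplication by `∑ aₙ Xⁿ`, the operator `∑ aₙ ∘ xEndⁿ`. -/
def toEnd : OrePolynomial σ δ →+ AddMonoid.End (OrePolynomial σ δ) :=
  lift fun n => (AddMonoidHom.mulRight (xEnd ^ n)).comp scalarEnd

lemma toEnd_monomial (n : ℕ) (a : D) :
    toEnd (monomial n a : OrePolynomial σ δ) = scalarEnd a * xEnd ^ n :=
  lift_monomial _ n a

instance : Mul (OrePolynomial σ δ) := ⟨fun f g => toEnd f g⟩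

instance : One (OrePolynomial σ δ) := ⟨monomial 0 1⟩

lemma mul_eq (f g : OrePolynomial σ δ) : f * g = toEnd f g := rfl

lemma one_eq : (1 : OrePolynomial σ δ) = monomial 0 1 := rfl

lemma toEnd_one : toEnd (1 : OrePolynomial σ δ) = 1 := by
  rw [one_eq, toEnd_monomial, scalarEnd_one, pow_zero, mul_one]

lemma xEnd_pow_one (n : ℕ) : (xEnd ^ n) (1 : OrePolynomial σ δ) = monomial n 1 := by
  induction n with
  | zero => rfl
  | succ n ih =>
    have h1 : δ.toAddMonoidHom 1 = 0 := by
      have h : δ.toAddMonoidHom (1 * 1)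
        = σ 1 * δ.toAddMonoidHom 1 + δ.toAddMonoidHom 1 * 1 := δ.leibniz' 1 1
      simpa using h
    rw [pow_succ', end_mul_apply, ih, xEnd_monomial, h1]
    simp

lemma toEnd_apply_one (f : OrePolynomial σ δ) : toEnd f 1 = f := by
  have h : (AddMonoidHom.eval (1 : OrePolynomial σ δ)).comp toEnd
      = AddMonoidHom.id (OrePolynomial σ δ) := hom_ext fun n a => by
    change toEnd (monomial n a) 1 = monomial n a
    rw [toEnd_monomial, end_mul_apply, xEnd_pow_one, scalarEnd_monomial, mul_one]
  exact DFunLike.congr_fun h f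

lemma toEnd_scalarEnd (a : D) (g : OrePolynomial σ δ) :
    toEnd (scalarEnd a g) = scalarEnd a * toEnd g := by
  have h : toEnd.comp (scalarEnd a : OrePolynomial σ δ →+ OrePolynomial σ δ)
      = (AddMonoidHom.mulLeft (scalarEnd a)).comp toEnd := hom_ext fun n b => by
    change toEnd (scalarEnd a (monomial n b)) = scalarEnd a * toEnd (monomial n b)
    rw [scalarEnd_monomial, toEnd_monomial, toEnd_monomial, scalarEnd_mul, mul_assoc]
  exact DFunLike.congr_fun h g

lemma toEnd_xEnd (g : OrePolynomial σ δ) : toEnd (xEnd g) = xEnd * toEnd g := by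
  have h : toEnd.comp (xEnd : OrePolynomial σ δ →+ OrePolynomial σ δ)
      = (AddMonoidHom.mulLeft xEnd).comp toEnd := hom_ext fun n b => by
    change toEnd (xEnd (monomial n b)) = xEnd * toEnd (monomial n b)
    rw [xEnd_monomial, map_add, toEnd_monomial, toEnd_monomial, toEnd_monomial, ← mul_assoc,
      xEnd_mul_scalarEnd, add_mul, pow_succ', mul_assoc]
  exact DFunLike.congr_fun h g

lemma toEnd_xEnd_pow (n : ℕ) (g : OrePolynomial σ δ) :
    toEnd ((xEnd ^ n) g) = xEnd ^ n * toEnd g := by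
  induction n with
  | zero => rw [pow_zero, one_mul]; rfl
  | succ n ih => rw [pow_succ', end_mul_apply, toEnd_xEnd, ih, mul_assoc]

lemma toEnd_mul (f g : OrePolynomial σ δ) : toEnd (f * g) = toEnd f * toEnd g := by
  have h : toEnd.comp ((AddMonoidHom.eval g).comp toEnd)
      = (AddMonoidHom.mulRight (toEnd g)).comp (toEnd (σ := σ) (δ := δ)) := hom_ext fun n a => by
    change toEnd (toEnd (monomial n a) g) = toEnd (monomial n a) * toEnd g
    rw [toEnd_monomial, end_mul_apply, toEnd_scalarEnd, toEnd_xEnd_pow, mul_assoc]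
  exact DFunLike.congr_fun h f

instance : Ring (OrePolynomial σ δ) :=
  { (inferInstance : AddCommGroup (OrePolynomial σ δ)),
    (inferInstance : Mul (OrePolynomial σ δ)),
    (inferInstance : One (OrePolynomial σ δ)) with
    mul_assoc := fun f g h => by
      rw [mul_eq (f * g) h, toEnd_mul, end_mul_apply]; rfl
    one_mul := fun f => by rw [mul_eq, toEnd_one]; rfl
    mul_one := fun f => toEnd_apply_one f
    left_distrib := fun f g h => map_add (toEnd f) g h
    right_distrib := fun f g h => by rw [mul_eq, map_add]; rfl
    zero_mul := fun f => by rw [mul_eq, map_zero]; rfl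
    mul_zero := fun f => map_zero (toEnd f) }

/-- The embedding of `D` as the constant polynomials. -/
def C : D →+* OrePolynomial σ δ where
  toFun := monomial 0
  map_one' := rfl
  map_mul' a b := by
    rw [mul_eq, toEnd_monomial, pow_zero, mul_one, scalarEnd_monomial]
  map_zero' := map_zero _
  map_add' := map_add _

/-- The indeterminate. -/
def X : OrePolynomial σ δ := monomial 1 1

/-- The commutation rule of the Ore extension. -/
lemma X_mul_C (a : D) :
    (X * C a : OrePolynomial σ δ) = C (σ a) * X + C (δ.toAddMonoidHom a) := by
  change toEnd (monomial 1 1) (monomial 0 a)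
    = toEnd (monomial 0 (σ a)) (monomial 1 1) + monomial 0 (δ.toAddMonoidHom a)
  rw [toEnd_monomial, toEnd_monomial, scalarEnd_one, one_mul, pow_one, pow_zero, mul_one,
    xEnd_monomial, scalarEnd_monomial, mul_one]

lemma C_mul_X_pow (a : D) (n : ℕ) : (C a * X ^ n : OrePolynomial σ δ) = monomial n a := by
  have hX : toEnd (X : OrePolynomial σ δ) = xEnd := by
    rw [X, toEnd_monomial, scalarEnd_one, one_mul, pow_one]
  have hp : (X ^ n : OrePolynomial σ δ) = monomial n 1 := by
    induction n with
    | zero => rw [pow_zero]; rfl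
    | succ n ih =>
      rw [pow_succ', ih, mul_eq, hX, ← xEnd_pow_one, ← xEnd_pow_one, pow_succ',
        end_mul_apply]
  rw [hp]
  change toEnd (monomial 0 a) (monomial n 1) = monomial n a
  rw [toEnd_monomial, pow_zero, mul_one, scalarEnd_monomial, mul_one]

/-- `f` is irreducible if it has positive degree and, whenever `f = g h`, one of `g`, `h` lies
in `D`. -/
def IsIrreducible (f : OrePolynomial σ δ) : Prop :=
  0 < f.natDegree ∧ ∀ g h : OrePolynomial σ δ, f = g * h →
    g ∈ Set.range (C : D → OrePolynomial σ δ) ∨ h ∈ Set.range (C : D → OrePolynomial σ δ)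

/-- `f` is twosided if `R f = f R`. -/
def IsTwosided (f : OrePolynomial σ δ) : Prop :=
  {p | ∃ g, p = g * f} = {p | ∃ g, p = f * g}

/-- `b` is a bound of `f`: it is twosided and `R b` is the largest twosided ideal contained in
`R f`. (`Ideal` means left ideal, and `Ideal.span {f}` is `R f`.) -/
def IsBound (b f : OrePolynomial σ δ) : Prop :=
  b.IsTwosided ∧
    IsGreatest {I : Ideal (OrePolynomial σ δ) | I.IsTwoSided ∧ I ≤ Ideal.span {f}}
      (Ideal.span {b})

/-- `p` is a prime twosided polynomial: it is twosided of positive degree and `R p` is maximal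
among the proper twosided ideals. -/
def IsPrimeTwosided (p : OrePolynomial σ δ) : Prop :=
  p.IsTwosided ∧ 0 < p.natDegree ∧
    Maximal (fun I : Ideal (OrePolynomial σ δ) => I.IsTwoSided ∧ I ≠ ⊤) (Ideal.span {p})

end

end OrePolynomial

/-! ### Degrees and right division in the Ore extension. -/

namespace OrePolynomial

variable {D : Type*} [DivisionRing D] {σ : D ≃+* D} {δ : SkewDerivation σ}

/-! Suppose `f = g * h` with both factors of positive degree. Then `R f* ⊆ R f ⊆ R h ≠ R`. The ring
`A = R / R f*` is simple and spanned by `r` elements over its center, so `A ≅ Mₙ(Δ)` by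
Wedderburn–Artin. The `n²` matrix units are independent over the center, whence `n ≤ √r`
(`IsSimpleRing.exists_sq_le_of_span_center`). By maximality `R f*` is the whole annihilator of `R /
R h`, so no diagonal idempotent of `A` kills `R / R h`. One suitable vector per idempotent gives a
left-linear embedding of `A` into `(R / R h)ⁿ` (`Ideal.exists_sq_le_forall_mem_of_maximal`).
Counting dimensions over `D` (`natDegree_le_mul_of_ker_eq`) yields `deg f* ≤ n deg h ≤ √r deg h < √r
deg f`, against the assumed equality. -/

@[ext]
lemma ext_coeff {f g : OrePolynomial σ δ} (h : ∀ n, f.coeff n = g.coeff n) : f = g :=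
  Finsupp.ext h

lemma coeff_add (f g : OrePolynomial σ δ) (n : ℕ) :
    (f + g).coeff n = f.coeff n + g.coeff n := rfl

lemma coeff_sub (f g : OrePolynomial σ δ) (n : ℕ) :
    (f - g).coeff n = f.coeff n - g.coeff n := rfl

lemma coeff_zero (n : ℕ) : (0 : OrePolynomial σ δ).coeff n = 0 := rfl

/-- Taking the coefficient of `Xⁿ`, as an additive map. -/
def coeffHom (n : ℕ) : OrePolynomial σ δ →+ D := Finsupp.applyAddHom n

lemma coeff_sum {ι : Type*} (s : Finset ι) (f : ι → OrePolynomial σ δ) (n : ℕ) :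
    (∑ i ∈ s, f i).coeff n = ∑ i ∈ s, (f i).coeff n :=
  map_sum (coeffHom n) f s

lemma coeff_monomial (m n : ℕ) (a : D) :
    (monomial m a : OrePolynomial σ δ).coeff n = if m = n then a else 0 :=
  Finsupp.single_apply

lemma coeff_C_mul (a : D) (f : OrePolynomial σ δ) (n : ℕ) :
    (C a * f).coeff n = a * f.coeff n := by
  have h : (coeffHom n).comp (AddMonoidHom.mulLeft (C a : OrePolynomial σ δ))
      = (AddMonoidHom.mulLeft a).comp (coeffHom n) := hom_ext fun m b => by
    change ((C a : OrePolynomial σ δ) * monomial m b).coeff n = a * (monomial m b : OrePolynomial σ δ).coeff n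
    rw [← C_mul_X_pow, ← mul_assoc, ← map_mul, C_mul_X_pow, C_mul_X_pow, coeff_monomial,
      coeff_monomial, mul_ite, mul_zero]
  exact DFunLike.congr_fun h f

lemma coeff_X_mul_succ (f : OrePolynomial σ δ) (n : ℕ) :
    (X * f).coeff (n + 1) = σ (f.coeff n) + δ.toAddMonoidHom (f.coeff (n + 1)) := by
  have h : (coeffHom (n + 1)).comp (AddMonoidHom.mulLeft (X : OrePolynomial σ δ))
      = (σ : D →+ D).comp (coeffHom n) + δ.toAddMonoidHom.comp (coeffHom (n + 1)) :=
    hom_ext fun m b => by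
      change ((X : OrePolynomial σ δ) * monomial m b).coeff (n + 1)
        = σ ((monomial m b : OrePolynomial σ δ).coeff n)
          + δ.toAddMonoidHom ((monomial m b : OrePolynomial σ δ).coeff (n + 1))
      rw [X, mul_eq, toEnd_monomial, scalarEnd_one, one_mul, pow_one, xEnd_monomial, coeff_add]
      simp only [coeff_monomial, Nat.add_right_cancel_iff]
      split_ifs <;> simp
  exact DFunLike.congr_fun h f

lemma coeff_eq_zero_of_natDegree_lt {f : OrePolynomial σ δ} {n : ℕ} (h : f.natDegree < n) :
    f.coeff n = 0 := by
  by_contra hn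
  exact h.not_ge (Finset.le_sup (f := id) (Finsupp.mem_support_iff.2 hn))

lemma natDegree_le_iff {f : OrePolynomial σ δ} {n : ℕ} :
    f.natDegree ≤ n ↔ ∀ k, n < k → f.coeff k = 0 := by
  refine ⟨fun h k hk => coeff_eq_zero_of_natDegree_lt (h.trans_lt hk), fun h =>
    Finset.sup_le fun k hk => ?_⟩
  by_contra hkn
  exact Finsupp.mem_support_iff.1 hk (h k (not_le.1 hkn))

lemma coeff_natDegree_ne_zero {f : OrePolynomial σ δ} (hf : f ≠ 0) :
    f.coeff f.natDegree ≠ 0 := by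
  intro h0
  apply hf
  rcases Nat.eq_zero_or_pos f.natDegree with hd | hd
  · ext n
    rcases Nat.eq_zero_or_pos n with rfl | hn
    · rwa [hd] at h0
    · exact coeff_eq_zero_of_natDegree_lt (hd ▸ hn)
  -- In positive degree, a vanishing top coefficient would allow the smaller degree bound
  -- `f.natDegree - 1`.
  · have : f.natDegree ≤ f.natDegree - 1 := natDegree_le_iff.2 fun k hk => by
      rcases Nat.lt_or_ge f.natDegree k with h | h
      · exact coeff_eq_zero_of_natDegree_lt h
      · rwa [show k = f.natDegree by omega]
    omega

lemma le_natDegree_of_coeff_ne_zero {f : OrePolynomial σ δ} {n : ℕ} (h : f.coeff n ≠ 0) :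
    n ≤ f.natDegree := by
  by_contra hn
  exact h (coeff_eq_zero_of_natDegree_lt (not_le.1 hn))

lemma natDegree_eq_zero_iff {f : OrePolynomial σ δ} :
    f.natDegree = 0 ↔ f ∈ Set.range (C : D → OrePolynomial σ δ) := by
  constructor
  · intro h
    refine ⟨f.coeff 0, ext_coeff fun n => ?_⟩
    change (monomial 0 (f.coeff 0) : OrePolynomial σ δ).coeff n = _
    rw [coeff_monomial]
    split_ifs with hn
    · rw [hn]
    · exact (coeff_eq_zero_of_natDegree_lt (by omega)).symm
  · rintro ⟨a, rfl⟩
    refine Nat.le_zero.1 (natDegree_le_iff.2 fun k hk => ?_)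
    change (monomial 0 a : OrePolynomial σ δ).coeff k = 0
    rw [coeff_monomial, if_neg hk.ne]

lemma natDegree_X_pow_mul_le (m : ℕ) (f : OrePolynomial σ δ) :
    (X ^ m * f).natDegree ≤ m + f.natDegree := by
  induction m with
  | zero => simp
  | succ m ih =>
    rw [pow_succ', mul_assoc, natDegree_le_iff]
    intro k hk
    obtain ⟨k, rfl⟩ : ∃ j, k = j + 1 := ⟨k - 1, by omega⟩
    rw [coeff_X_mul_succ, natDegree_le_iff.1 ih k (by omega),
      natDegree_le_iff.1 ih (k + 1) (by omega), map_zero, map_zero, add_zero]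

/-- Each multiplication by `X` applies `σ` to the leading coefficient, while `δ` only affects lower
terms; `σ` is injective. -/
lemma coeff_X_pow_mul_ne_zero (m : ℕ) {f : OrePolynomial σ δ} (hf : f ≠ 0) :
    (X ^ m * f).coeff (m + f.natDegree) ≠ 0 := by
  induction m with
  | zero => simpa using coeff_natDegree_ne_zero hf
  | succ m ih =>
    rw [pow_succ', mul_assoc, show m + 1 + f.natDegree = m + f.natDegree + 1 by omega,
      coeff_X_mul_succ, natDegree_le_iff.1 (natDegree_X_pow_mul_le m f) _ (Nat.lt_succ_self _),
      map_zero, add_zero]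
    simpa using ih

lemma eq_sum_C_mul_X_pow (f : OrePolynomial σ δ) {N : ℕ} (h : f.natDegree < N) :
    f = ∑ i ∈ Finset.range N, C (f.coeff i) * X ^ i := by
  ext n
  simp only [coeff_sum, C_mul_X_pow, coeff_monomial, Finset.sum_ite_eq', Finset.mem_range]
  split_ifs with hn
  · rfl
  · exact coeff_eq_zero_of_natDegree_lt (by omega)

lemma natDegree_mul {f g : OrePolynomial σ δ} (hf : f ≠ 0) (hg : g ≠ 0) :
    (f * g).natDegree = f.natDegree + g.natDegree := by
  have key (k : ℕ) : (f * g).coeff k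
      = ∑ i ∈ Finset.range (f.natDegree + 1), f.coeff i * (X ^ i * g).coeff k := by
    conv_lhs => rw [eq_sum_C_mul_X_pow f (Nat.lt_succ_self _), Finset.sum_mul, coeff_sum]
    simp only [mul_assoc, coeff_C_mul]
  have hz (i k : ℕ) (h : i + g.natDegree < k) : (X ^ i * g).coeff k = 0 :=
    natDegree_le_iff.1 (natDegree_X_pow_mul_le i g) k h
  apply le_antisymm
  · refine natDegree_le_iff.2 fun k hk => ?_
    rw [key]
    refine Finset.sum_eq_zero fun i hi => ?_
    rw [hz i k (by have := Finset.mem_range.1 hi; omega), mul_zero]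
  · apply le_natDegree_of_coeff_ne_zero
    rw [key, Finset.sum_range_succ, Finset.sum_eq_zero, zero_add]
    · exact mul_ne_zero (coeff_natDegree_ne_zero hf) (coeff_X_pow_mul_ne_zero _ hg)
    · intro i hi
      rw [hz i _ (by have := Finset.mem_range.1 hi; omega), mul_zero]

/-- Division with remainder by a nonzero polynomial on the right. -/
lemma exists_sub_mul_coeff_eq_zero {h : OrePolynomial σ δ} (hh : h ≠ 0) (f : OrePolynomial σ δ) :
    ∃ q : OrePolynomial σ δ, ∀ k, h.natDegree ≤ k → (f - q * h).coeff k = 0 := by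
  suffices H : ∀ (N : ℕ) (f : OrePolynomial σ δ), (∀ k, N ≤ k → f.coeff k = 0) →
      ∃ q : OrePolynomial σ δ, ∀ k, h.natDegree ≤ k → (f - q * h).coeff k = 0 from
    H (f.natDegree + 1) f fun k hk => coeff_eq_zero_of_natDegree_lt hk
  intro N
  induction N with
  | zero => exact fun f hf => ⟨0, fun k _ => by simpa using hf k (Nat.zero_le k)⟩
  | succ N ih =>
    intro f hf
    by_cases hN : h.natDegree ≤ N
    · set m := N - h.natDegree
      have hm : m + h.natDegree = N := by omega
      -- `X ^ m` twists the leading coefficient of `h` by `σ ^ m`, so the coefficient to invert is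
      -- that of `X ^ m * h`. This `a` cancels the `X ^ N` term of `f`.
      set a := f.coeff N * ((X ^ m * h).coeff N)⁻¹
      obtain ⟨q, hq⟩ := ih (f - C a * (X ^ m * h)) fun k hk => by
        rw [coeff_sub, coeff_C_mul]
        rcases hk.eq_or_lt with rfl | hk
        · have := coeff_X_pow_mul_ne_zero m hh
          rw [hm] at this
          rw [inv_mul_cancel_right₀ this, sub_self]
        · rw [hf k hk, natDegree_le_iff.1 (natDegree_X_pow_mul_le m h) k (hm ▸ hk), mul_zero,
            sub_zero]
      exact ⟨C a * X ^ m + q, fun k hk => by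
        rw [add_mul, mul_assoc, ← sub_sub]; exact hq k hk⟩
    · exact ⟨0, fun k hk => by simpa using hf k (by omega)⟩

/-! ### Dimension of `R / R h` over `D`. -/

/-- The left vector space structure of `D[X; σ, δ]`. -/
noncomputable instance : Module D (OrePolynomial σ δ) :=
  Module.compHom (OrePolynomial σ δ) (C : D →+* OrePolynomial σ δ)

lemma smul_eq_C_mul (a : D) (f : OrePolynomial σ δ) : a • f = C a * f := rfl

instance : IsScalarTower D (OrePolynomial σ δ) (OrePolynomial σ δ) :=
  ⟨fun a f g => mul_assoc (C a) f g⟩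

lemma span_range_mk_X_pow {h : OrePolynomial σ δ} (hh : h ≠ 0) :
    Submodule.span D (Set.range fun i : Fin h.natDegree =>
      (Submodule.Quotient.mk (X ^ (i : ℕ)) : OrePolynomial σ δ ⧸ Ideal.span {h})) = ⊤ := by
  refine eq_top_iff.2 fun x _ => ?_
  obtain ⟨f, rfl⟩ := Submodule.Quotient.mk_surjective _ x
  obtain ⟨q, hq⟩ := exists_sub_mul_coeff_eq_zero hh f
  have h1 : (Submodule.Quotient.mk f : OrePolynomial σ δ ⧸ Ideal.span {h})
      = Submodule.Quotient.mk (f - q * h) :=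
    (Submodule.Quotient.eq _).2 (by
      rw [sub_sub_cancel]; exact Ideal.mul_mem_left _ q (Ideal.mem_span_singleton_self h))
  have h2 : f - q * h = ∑ i : Fin h.natDegree, (f - q * h).coeff i • X ^ (i : ℕ) := by
    ext n
    rw [Fin.sum_univ_eq_sum_range (fun i => (f - q * h).coeff i • (X ^ i : OrePolynomial σ δ))
      h.natDegree]
    simp only [coeff_sum, smul_eq_C_mul, C_mul_X_pow, coeff_monomial, Finset.sum_ite_eq',
      Finset.mem_range]
    split_ifs with hn
    · rfl
    · exact hq n (not_lt.1 hn)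
  rw [h1, h2, ← Submodule.mkQ_apply, map_sum]
  refine Submodule.sum_mem _ fun i _ => ?_
  exact Submodule.smul_mem _ _ (Submodule.subset_span (Set.mem_range_self i))

lemma module_finite_quotient {h : OrePolynomial σ δ} (hh : h ≠ 0) :
    Module.Finite D (OrePolynomial σ δ ⧸ Ideal.span {h}) :=
  Module.Finite.of_surjective _ (LinearMap.range_eq_top.1 <|
    (Fintype.range_linearCombination D _).trans (span_range_mk_X_pow hh))

lemma finrank_quotient_le {h : OrePolynomial σ δ} (hh : h ≠ 0) :
    Module.finrank D (OrePolynomial σ δ ⧸ Ideal.span {h}) ≤ h.natDegree := by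
  rw [← finrank_top, ← span_range_mk_X_pow hh]
  exact (finrank_range_le_card _).trans_eq (Fintype.card_fin _)

/-- If `R / R p` embeds into `(R / R h)ⁿ`, then `deg p ≤ n deg h`. -/
lemma natDegree_le_mul_of_ker_eq {p h : OrePolynomial σ δ} (hh : h ≠ 0) {n : ℕ}
    (v : Fin n → OrePolynomial σ δ)
    (hv : ∀ a : OrePolynomial σ δ, (∀ j, a * v j ∈ Ideal.span {h}) → a ∈ Ideal.span {p}) :
    p.natDegree ≤ n * h.natDegree := by
  have := module_finite_quotient hh
  -- The map `a ↦ (a * v j)ⱼ`, restricted to the `p.natDegree`-dimensional space of polynomials `a`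
  -- of degree below that of `p`. It is `D`-linear because scalars act on the left.
  let φ : (Fin p.natDegree → D) →ₗ[D] (Fin n → OrePolynomial σ δ ⧸ Ideal.span {h}) :=
    LinearMap.pi fun j => Fintype.linearCombination D fun i =>
      Submodule.Quotient.mk (X ^ (i : ℕ) * v j)
  have hφ : Function.Injective φ := by
    rw [injective_iff_map_eq_zero]
    intro c hc
    let a : OrePolynomial σ δ := ∑ i, c i • X ^ (i : ℕ)
    have hcoeff (k : ℕ) : a.coeff k = if hk : k < p.natDegree then c ⟨k, hk⟩ else 0 := by
      simp only [a, coeff_sum, smul_eq_C_mul, C_mul_X_pow, coeff_monomial]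
      split_ifs with hk
      · rw [Finset.sum_eq_single ⟨k, hk⟩]
        · simp
        · exact fun i _ hi => if_neg fun h => hi (Fin.ext h)
        · simp
      · exact Finset.sum_eq_zero fun i _ => if_neg (by have := i.2; omega)
    have ha : a ∈ Ideal.span {p} := hv a fun j => by
      rw [← Submodule.Quotient.mk_eq_zero]
      have hj : φ c j = 0 := congrFun hc j
      rw [← hj]
      simp only [φ, a, LinearMap.pi_apply, Fintype.linearCombination_apply, Finset.sum_mul,
        ← Submodule.mkQ_apply, map_sum]
      exact Finset.sum_congr rfl fun i _ => by rw [smul_mul_assoc]; rfl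
    obtain ⟨q, hq⟩ := Ideal.mem_span_singleton'.1 ha
    -- A nonzero left multiple of `p` has degree at least that of `p`.
    have ha0 : a = 0 := by
      by_contra h0
      have hq0 : q ≠ 0 := by rintro rfl; exact h0 (by rw [← hq, zero_mul])
      have hp0 : p ≠ 0 := by rintro rfl; exact h0 (by rw [← hq, mul_zero])
      have hd := natDegree_mul hq0 hp0
      rw [hq] at hd
      apply coeff_natDegree_ne_zero h0
      rw [hcoeff, dif_neg (by omega)]
    funext i
    have := hcoeff i
    rw [ha0, coeff_zero, dif_pos i.2] at this
    exact this.symm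
  have := LinearMap.finrank_le_finrank_of_injective hφ
  rw [Module.finrank_fin_fun, Module.finrank_pi_fintype, Finset.sum_const, Finset.card_univ,
    Fintype.card_fin, smul_eq_mul] at this
  exact this.trans (Nat.mul_le_mul_left n (finrank_quotient_le hh))

end OrePolynomial

/-! ### Simple rings spanned by `r` elements over their center. -/

section SimpleRing

/-- The matrix units are linearly independent over the center of a matrix ring. -/
lemma Matrix.linearIndependent_single_center {n : ℕ} {Δ A : Type*} [DivisionRing Δ] [Ring A]
    (e : A ≃+* Matrix (Fin n) (Fin n) Δ) :
    LinearIndependent (Subring.center A)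
      fun p : Fin n × Fin n => e.symm (Matrix.single p.1 p.2 1) := by
  rw [Fintype.linearIndependent_iff]
  intro c hc p
  have hM (q : Fin n × Fin n) (B : Matrix (Fin n) (Fin n) Δ) :
      e (c q : A) * B = B * e (c q : A) := by
    have := congrArg e (Subring.mem_center_iff.1 (c q).2 (e.symm B))
    simpa using this.symm
  have h0 : ∑ q : Fin n × Fin n, e (c q : A) * Matrix.single q.1 q.2 (1 : Δ) = 0 := by
    have := congrArg e hc
    rw [map_sum, map_zero] at this
    rw [← this]
    exact Finset.sum_congr rfl fun q _ => by
      rw [Subring.smul_def, smul_eq_mul, map_mul, e.apply_symm_apply]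
  -- Central coefficients commute with matrix units, so multiplying the relation by `E k p.1` on the
  -- left and `E p.2 k` on the right isolates `c p * E k k`. Summing over `k` then gives `c p`.
  have hk (k : Fin n) : e (c p : A) * Matrix.single k k (1 : Δ) = 0 := by
    have h1 : ∑ q : Fin n × Fin n, Matrix.single k p.1 (1 : Δ) *
        (e (c q : A) * Matrix.single q.1 q.2 (1 : Δ)) * Matrix.single p.2 k (1 : Δ) = 0 := by
      rw [← Finset.sum_mul, ← Finset.mul_sum, h0, mul_zero, zero_mul]
    rw [Finset.sum_eq_single p] at h1
    · rw [← h1, ← mul_assoc, ← hM]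
      simp [mul_assoc]
    · intro q _ hq
      rw [← mul_assoc, ← hM, mul_assoc, mul_assoc]
      by_cases h : q.1 = p.1
      · have h2 : q.2 ≠ p.2 := fun h2 => hq (Prod.ext h h2)
        rw [Matrix.single_mul_single_of_ne _ _ _ _ h2, mul_zero, mul_zero]
      · rw [← mul_assoc (Matrix.single k p.1 (1 : Δ)),
          Matrix.single_mul_single_of_ne _ _ _ _ (Ne.symm h), zero_mul, mul_zero]
    · simp
  have h1 : e (c p : A) = 0 := by
    rw [← mul_one (e (c p : A)), ← Matrix.sum_single_one, Finset.mul_sum]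
    exact Finset.sum_eq_zero fun k _ => hk k
  exact Subtype.ext ((map_eq_zero_iff e e.injective).1 h1)

/-- A simple ring spanned by `r` elements over its center has `n` nonzero elements `v j` with
`n ^ 2 ≤ r` such that each nonzero `a` satisfies `b a (v j) = v j` for some `b` and `j`. -/
lemma IsSimpleRing.exists_sq_le_of_span_center {A : Type*} [Ring A] [IsSimpleRing A]
    {r : ℕ} (s : Fin r → A) (hs : Submodule.span (Subring.center A) (Set.range s) = ⊤) :
    ∃ (n : ℕ) (v : Fin n → A), n ^ 2 ≤ r ∧ (∀ j, v j ≠ 0) ∧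
      ∀ a ≠ 0, ∃ j b, b * a * v j = v j := by
  classical
  let : Field (Subring.center A) := (IsSimpleRing.isField_center A).toField
  have : Module.Finite (Subring.center A) A :=
    ⟨hs ▸ Submodule.fg_span (Set.finite_range s)⟩
  have : IsArtinianRing A := IsArtinianRing.of_finite (Subring.center A) A
  obtain ⟨n, _, Δ, _, ⟨e⟩⟩ := IsSimpleRing.exists_ringEquiv_matrix_divisionRing A
  -- The `v j` are the diagonal idempotents.
  refine ⟨n, fun j => e.symm (Matrix.single j j 1), ?_, fun j hj => ?_, fun a ha => ?_⟩
  · have h1 := (Matrix.linearIndependent_single_center e).fintype_card_le_finrank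
    have h2 := finrank_range_le_card (R := Subring.center A) s
    rw [Set.finrank, hs, finrank_top, Fintype.card_fin] at h2
    rw [Fintype.card_prod, Fintype.card_fin] at h1
    rw [sq]
    exact h1.trans h2
  · rw [map_eq_zero_iff _ e.symm.injective] at hj
    simpa using congrFun (congrFun hj j) j
  · obtain ⟨i, j, hij⟩ : ∃ i j, e a i j ≠ 0 := by
      by_contra! h
      exact ha ((map_eq_zero_iff e e.injective).1 (Matrix.ext h))
    -- Sandwiching `a` between `E j i` and `E j j` moves its `(i, j)` entry to position `(j, j)`;
    -- the inverse normalizes it to `1`.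
    refine ⟨j, e.symm (Matrix.single j i (e a i j)⁻¹), e.injective ?_⟩
    rw [map_mul, map_mul, e.apply_symm_apply, e.apply_symm_apply, Matrix.single_mul_mul_single,
      inv_mul_cancel₀ hij, one_mul]

/-- The quotient by a maximal twosided ideal is simple. -/
lemma Ideal.Quotient.isSimpleRing {R : Type*} [Ring R] (I : Ideal R) [I.IsTwoSided]
    (hI : Maximal (fun J : Ideal R => J.IsTwoSided ∧ J ≠ ⊤) I) : IsSimpleRing (R ⧸ I) := by
  have : Nontrivial (R ⧸ I) := Ideal.Quotient.nontrivial_iff.2 hI.prop.2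
  refine ⟨⟨fun J => ?_⟩⟩
  let K : TwoSidedIdeal R := J.comap (Ideal.Quotient.mk I)
  have hIK : I ≤ K.asIdeal := fun x hx => by
    rw [TwoSidedIdeal.mem_asIdeal, TwoSidedIdeal.mem_comap, Ideal.Quotient.eq_zero_iff_mem.2 hx]
    exact J.zero_mem
  by_cases hK : K.asIdeal = ⊤
  · refine Or.inr (eq_top_iff.2 fun x _ => ?_)
    obtain ⟨x, rfl⟩ := Ideal.Quotient.mk_surjective x
    have : x ∈ K.asIdeal := hK ▸ Submodule.mem_top
    rwa [TwoSidedIdeal.mem_asIdeal, TwoSidedIdeal.mem_comap] at this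
  · refine Or.inl (eq_bot_iff.2 fun x hx => ?_)
    obtain ⟨x, rfl⟩ := Ideal.Quotient.mk_surjective x
    have hxK : x ∈ K.asIdeal := by
      rwa [TwoSidedIdeal.mem_asIdeal, TwoSidedIdeal.mem_comap]
    have := hI.le_of_ge ⟨inferInstance, hK⟩ hIK hxK
    rw [Ideal.Quotient.eq_zero_iff_mem.2 this]
    exact TwoSidedIdeal.zero_mem _

/-- If `I` is a maximal twosided ideal of a ring spanned by `r` elements over its center and `L` a
proper left ideal containing `I`, then `R / I` embeds into `(R / L)ⁿ` for some `n` with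
`n ^ 2 ≤ r`. -/
lemma Ideal.exists_sq_le_forall_mem_of_maximal {R : Type*} [Ring R] {r : ℕ} (s : Fin r → R)
    (hs : Submodule.span (Subring.center R) (Set.range s) = ⊤) {I L : Ideal R}
    (hI : Maximal (fun J : Ideal R => J.IsTwoSided ∧ J ≠ ⊤) I) (hIL : I ≤ L) (hL : L ≠ ⊤) :
    ∃ (n : ℕ) (v : Fin n → R), n ^ 2 ≤ r ∧ ∀ a, (∀ j, a * v j ∈ L) → a ∈ I := by
  have : I.IsTwoSided := hI.prop.1
  have := Ideal.Quotient.isSimpleRing I hI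
  -- The center of `R` maps into the center of `R / I`, so a spanning family stays spanning.
  have hspan : Submodule.span (Subring.center (R ⧸ I))
      (Set.range fun i => Ideal.Quotient.mk I (s i)) = ⊤ := by
    refine (Submodule.eq_top_iff').2 fun x => ?_
    obtain ⟨x, rfl⟩ := Ideal.Quotient.mk_surjective x
    have hx : x ∈ Submodule.span (Subring.center R) (Set.range s) := hs ▸ Submodule.mem_top
    induction hx using Submodule.span_induction with
    | mem x hx =>
      obtain ⟨i, rfl⟩ := hx
      exact Submodule.subset_span ⟨i, rfl⟩
    | zero => rw [map_zero]; exact Submodule.zero_mem _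
    | add x y _ _ hx hy => rw [map_add]; exact Submodule.add_mem _ hx hy
    | smul c x _ hx =>
      have hc : Ideal.Quotient.mk I (c : R) ∈ Subring.center (R ⧸ I) := by
        refine Subring.mem_center_iff.2 fun y => ?_
        obtain ⟨y, rfl⟩ := Ideal.Quotient.mk_surjective y
        rw [← map_mul, Subring.mem_center_iff.1 c.2 y, map_mul]
      rw [Subring.smul_def, smul_eq_mul, map_mul]
      exact Submodule.smul_mem _ (⟨_, hc⟩ : Subring.center (R ⧸ I)) hx
  obtain ⟨n, v, hn, hv0, hv⟩ := IsSimpleRing.exists_sq_le_of_span_center _ hspan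
  choose w hw using fun j => Ideal.Quotient.mk_surjective (v j)
  -- The annihilator of `R / L`: a proper twosided ideal containing `I`, hence equal to `I`.
  let J : Ideal R :=
    { carrier := {a | ∀ b, a * b ∈ L}
      zero_mem' := fun b => by rw [zero_mul]; exact L.zero_mem
      add_mem' := fun ha ha' b => by rw [add_mul]; exact L.add_mem (ha b) (ha' b)
      smul_mem' := fun c a ha b => by
        rw [smul_eq_mul, mul_assoc]; exact L.mul_mem_left c (ha b) }
  have hJ : J.IsTwoSided := ⟨fun b ha c => by rw [mul_assoc]; exact ha (b * c)⟩
  have hJtop : J ≠ ⊤ := fun h => hL <| (Ideal.eq_top_iff_one L).2 <| by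
    have h1 : (1 : R) ∈ J := h ▸ Submodule.mem_top
    simpa using h1 1
  have hJI : J ≤ I := hI.le_of_ge ⟨hJ, hJtop⟩ fun a ha b => hIL (Ideal.mul_mem_right b I ha)
  -- Otherwise `w j` would annihilate `R / L`, forcing `v j = 0`.
  have hm (j : Fin n) : ∃ m, w j * m ∉ L := by
    by_contra! h
    exact hv0 j (by rw [← hw, Ideal.Quotient.eq_zero_iff_mem]; exact hJI h)
  choose m hm using hm
  refine ⟨n, fun j => w j * m j, hn, fun a ha => ?_⟩
  by_contra haI
  obtain ⟨j, b, hb⟩ := hv (Ideal.Quotient.mk I a) (by rwa [Ne, Ideal.Quotient.eq_zero_iff_mem])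
  obtain ⟨b, rfl⟩ := Ideal.Quotient.mk_surjective b
  rw [← hw, ← map_mul, ← map_mul, Ideal.Quotient.eq] at hb
  -- Modulo `L`, `b * a * w j * m j` equals `w j * m j`, which is nonzero, whereas `a * w j * m j ∈
  -- L` would make it zero.
  have h1 := hIL (Ideal.mul_mem_right (m j) I hb)
  have h2 := L.mul_mem_left b (ha j)
  apply hm j
  have h3 := L.sub_mem h2 h1
  rwa [sub_mul, mul_assoc, mul_assoc, sub_sub_cancel] at h3

end SimpleRing

/-! ### Irreducibility by comparison of degrees. -/

theorem proposition5p1 {D : Type*} [DivisionRing D] (σ : D ≃+* D) (δ : SkewDerivation σ)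
    [Module.Free (Subring.center (OrePolynomial σ δ)) (OrePolynomial σ δ)]
    [Module.Finite (Subring.center (OrePolynomial σ δ)) (OrePolynomial σ δ)]
    (r : ℕ) (hr : Module.finrank (Subring.center (OrePolynomial σ δ)) (OrePolynomial σ δ) = r)
    (f fstar : OrePolynomial σ δ) (hbound : OrePolynomial.IsBound fstar f)
    (hcenter : fstar ∈ Subring.center (OrePolynomial σ δ))
    (hprime : fstar.IsPrimeTwosided)
    (hdeg : (fstar.natDegree : ℝ) = Real.sqrt (r : ℝ) * (f.natDegree : ℝ)) :
    f.IsIrreducible := by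
  obtain ⟨-, hpos, hmax⟩ := hprime
  have hpos' : (0 : ℝ) < Real.sqrt r * f.natDegree := hdeg ▸ Nat.cast_pos.2 hpos
  have hf : 0 < f.natDegree := by
    rcases Nat.eq_zero_or_pos f.natDegree with h | h
    · simp [h] at hpos'
    · exact h
  refine ⟨hf, fun g h hgh => ?_⟩
  by_contra! hcon
  rw [← OrePolynomial.natDegree_eq_zero_iff, ← OrePolynomial.natDegree_eq_zero_iff] at hcon
  have hg0 : g ≠ 0 := by rintro rfl; exact hcon.1 rfl
  have hh0 : h ≠ 0 := by rintro rfl; exact hcon.2 rfl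
  have hlt : h.natDegree < f.natDegree := by
    rw [hgh, OrePolynomial.natDegree_mul hg0 hh0]
    have := hcon.1
    omega
  -- From the bound, `R f* ⊆ R f`; and `f = g * h` is a left multiple of `h`.
  have hle : Ideal.span {fstar} ≤ Ideal.span {h} := hbound.2.1.2.trans <| by
    rw [Ideal.span_singleton_le_iff_mem, hgh]
    exact Ideal.mul_mem_left _ g (Ideal.mem_span_singleton_self h)
  have htop : Ideal.span {h} ≠ ⊤ := fun htop => by
    obtain ⟨q, hq⟩ := Ideal.mem_span_singleton'.1 ((Ideal.eq_top_iff_one _).1 htop)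
    have h1 : (1 : OrePolynomial σ δ).natDegree = 0 :=
      OrePolynomial.natDegree_eq_zero_iff.2 ⟨1, map_one _⟩
    have hq0 : q ≠ 0 := by
      rintro rfl
      rw [zero_mul] at hq
      exact hh0 (by rw [← one_mul h, ← hq, zero_mul])
    rw [← hq, OrePolynomial.natDegree_mul hq0 hh0] at h1
    exact hcon.2 (by omega)
  have : Nontrivial (OrePolynomial σ δ) := ⟨h, 0, hh0⟩
  obtain ⟨n, v, hn, hv⟩ := Ideal.exists_sq_le_forall_mem_of_maximal
    (Module.finBasisOfFinrankEq (Subring.center (OrePolynomial σ δ)) (OrePolynomial σ δ) hr)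
    (Module.Basis.span_eq _) hmax hle htop
  have hdle : (fstar.natDegree : ℝ) ≤ n * h.natDegree := by
    exact_mod_cast OrePolynomial.natDegree_le_mul_of_ker_eq hh0 v hv
  have hnr : (n : ℝ) ≤ Real.sqrt r := Real.le_sqrt_of_sq_le (by exact_mod_cast hn)
  have hr0 : 0 < Real.sqrt (r : ℝ) := pos_of_mul_pos_left hpos' (Nat.cast_nonneg _)
  have h1 : (n : ℝ) * h.natDegree ≤ Real.sqrt r * h.natDegree := by gcongr
  -- Strict because `√r > 0` and `g` has positive degree.
  have h2 : Real.sqrt r * h.natDegree < Real.sqrt r * f.natDegree := by gcongr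
  linarith
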